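/- Let $m\in\mathbb N$, $0<\varepsilon<\pi$ and $k_0\in\mathbb Z$. For $j=1,2$ let $\{A_j(k)\}_{k\in\mathbb Z}$, $\{B_j(k)\}_{k\in\mathbb Z}$ be sequences of self-adjoint complex $m\times m$ matrices with $A_j(k)>0$ (positive definite) for all $k$ and $\sup_{k}(\|A_j(k)\|+\|B_j(k)\|)<\infty$, and let $H_j$ be the Jacobi operator in $\ell^2(\mathbb Z)^m$, $$(H_jf)(k)=A_j(k)f(k+1)+A_j(k-1)f(k-1)+B_j(k)f(k),\qquad k\in\mathbb Z.$$ For $z\in\mathbb C$ let $\theta_j(z,\cdot,k_0),\phi_j(z,\cdot,k_0)$ be the $m\times m$ matrix solutions of $$A_j(k)\psi(k+1)+A_j(k-1)\psi(k-1)+(B_j(k)-zI_m)\psi(k)=0,\qquad k\in\mathbb Z,$$ with $\theta_j(z,k_0,k_0)=\phi_j(z,k_0+1,k_0)=I_m$ and $\phi_j(z,k_0,k_0)=\theta_j(z,k_0+1,k_0)=0$, and for $z\in\mathbb C\setminus\mathbb R$ let the Weyl–Titchmarsh matrices $M_{j,\pm}(z,k_0)$ be the unique $m\times m$ matrices such that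 $$\theta_j(z,\cdot,k_0)-\phi_j(z,\cdot,k_0)A_j(k_0)^{-1}M_{j,\pm}(z,k_0)\in\ell^2((k_0,\pm\infty)\cap\mathbb Z)^{m\times m}.$$ (i) If for some integer $N\ge 2$ $$\|M_{1,-}(z,k_0)-M_{2,-}(z,k_0)\|=O(|z|^{-N})\quad\text{as }|z|\to\infty\text{ along the ray }\arg(z)=\pi-\varepsilon,$$ then $$A_1(k_0-1-k)=A_2(k_0-1-k),\quad k=0,\dots,\lfloor N/2\rfloor-1,$$ $$B_1(k_0-k)=B_2(k_0-k),\quad k=0,\dots,\lfloor (N-1)/2\rfloor.$$ (ii) If for some integer $N\ge 2$ $$\|M_{1,+}(z,k_0)-M_{2,+}(z,k_0)\|=O(|z|^{-N})\quad\text{as }|z|\to\infty\text{ along the ray }\arg(z)=\pi-\varepsilon,$$ and $B_1(k_0)=B_2(k_0)$, then $$A_1(k_0+k)=A_2(k_0+k),\quad k=0,\dots,\lfloor N/2\rfloor-1,$$ $$B_1(k_0+k)=B_2(k_0+k),\quad k=0,\dots,\lfloor (N-1)/2\rfloor.$$ -/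

import Mathlib

open scoped Asymptotics ComplexOrder Matrix.Norms.L2Operator

/-- Coefficient sequences of a bounded `m × m` matrix-valued Jacobi operator
`(H f)(k) = A k f(k+1) + A (k-1) f(k-1) + B k f(k)` in `ℓ²(ℤ)^m`: every `A k` is (self-adjoint
and) positive definite, every `B k` is self-adjoint, and both sequences are uniformly bounded. -/
structure IsJacobiData {m : ℕ} (A B : ℤ → Matrix (Fin m) (Fin m) ℂ) : Prop where
  posDef : ∀ k, (A k).PosDef
  isHermitian : ∀ k, (B k).IsHermitian
  bounded : ∃ C : ℝ, ∀ k, ‖A k‖ + ‖B k‖ ≤ C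

/-- `ψ` is a matrix solution of the Jacobi equation with spectral parameter `z` on all of `ℤ`. -/
def IsJacobiSolution {m : ℕ} (A B : ℤ → Matrix (Fin m) (Fin m) ℂ) (z : ℂ)
    (ψ : ℤ → Matrix (Fin m) (Fin m) ℂ) : Prop :=
  ∀ k : ℤ, A k * ψ (k + 1) + A (k - 1) * ψ (k - 1)
    + (B k - z • (1 : Matrix (Fin m) (Fin m) ℂ)) * ψ k = 0

/-- The pair `(ψ (k₀ + n), ψ (k₀ + n + 1))` for the solution `ψ` with `ψ k₀ = u`,
`ψ (k₀ + 1) = v`. -/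
noncomputable def jacobiForward {m : ℕ} (A B : ℤ → Matrix (Fin m) (Fin m) ℂ) (z : ℂ) (k₀ : ℤ)
    (u v : Matrix (Fin m) (Fin m) ℂ) :
    ℕ → Matrix (Fin m) (Fin m) ℂ × Matrix (Fin m) (Fin m) ℂ
  | 0 => (u, v)
  | n + 1 =>
    ((jacobiForward A B z k₀ u v n).2,
      (A (k₀ + n + 1))⁻¹ *
        ((z • (1 : Matrix (Fin m) (Fin m) ℂ) - B (k₀ + n + 1)) * (jacobiForward A B z k₀ u v n).2
          - A (k₀ + n) * (jacobiForward A B z k₀ u v n).1))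

/-- The pair `(ψ (k₀ - n), ψ (k₀ - n + 1))` for the solution `ψ` with `ψ k₀ = u`,
`ψ (k₀ + 1) = v`. -/
noncomputable def jacobiBackward {m : ℕ} (A B : ℤ → Matrix (Fin m) (Fin m) ℂ) (z : ℂ) (k₀ : ℤ)
    (u v : Matrix (Fin m) (Fin m) ℂ) :
    ℕ → Matrix (Fin m) (Fin m) ℂ × Matrix (Fin m) (Fin m) ℂ
  | 0 => (u, v)
  | n + 1 =>
    ((A (k₀ - n - 1))⁻¹ *
        ((z • (1 : Matrix (Fin m) (Fin m) ℂ) - B (k₀ - n)) * (jacobiBackward A B z k₀ u v n).1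
          - A (k₀ - n) * (jacobiBackward A B z k₀ u v n).2),
      (jacobiBackward A B z k₀ u v n).1)

/-- The solution `ψ` of the Jacobi equation with `ψ k₀ = u`, `ψ (k₀ + 1) = v`. -/
noncomputable def jacobiSolution {m : ℕ} (A B : ℤ → Matrix (Fin m) (Fin m) ℂ) (z : ℂ) (k₀ : ℤ)
    (u v : Matrix (Fin m) (Fin m) ℂ) (k : ℤ) : Matrix (Fin m) (Fin m) ℂ :=
  if k₀ ≤ k then (jacobiForward A B z k₀ u v (k - k₀).toNat).1
  else (jacobiBackward A B z k₀ u v (k₀ - k).toNat).1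

theorem jacobiSolution_add {m : ℕ} (A B : ℤ → Matrix (Fin m) (Fin m) ℂ) (z : ℂ) (k₀ : ℤ)
    (u v : Matrix (Fin m) (Fin m) ℂ) (n : ℕ) :
    jacobiSolution A B z k₀ u v (k₀ + n) = (jacobiForward A B z k₀ u v n).1 := by
  simp [jacobiSolution]

theorem jacobiSolution_sub {m : ℕ} (A B : ℤ → Matrix (Fin m) (Fin m) ℂ) (z : ℂ) (k₀ : ℤ)
    (u v : Matrix (Fin m) (Fin m) ℂ) (n : ℕ) :
    jacobiSolution A B z k₀ u v (k₀ - n) = (jacobiBackward A B z k₀ u v n).1 := by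
  rcases n with _ | n
  · simp [jacobiSolution, jacobiForward, jacobiBackward]
  · have h : ¬ (k₀ ≤ k₀ - ((n + 1 : ℕ) : ℤ)) := by push_cast; omega
    rw [jacobiSolution, if_neg h]
    congr 2
    push_cast
    omega

theorem jacobiSolution_zero {m : ℕ} (A B : ℤ → Matrix (Fin m) (Fin m) ℂ) (z : ℂ) (k₀ : ℤ)
    (u v : Matrix (Fin m) (Fin m) ℂ) : jacobiSolution A B z k₀ u v k₀ = u := by
  simp [jacobiSolution, jacobiForward]

theorem jacobiSolution_one {m : ℕ} (A B : ℤ → Matrix (Fin m) (Fin m) ℂ) (z : ℂ) (k₀ : ℤ)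
    (u v : Matrix (Fin m) (Fin m) ℂ) : jacobiSolution A B z k₀ u v (k₀ + 1) = v := by
  simpa [jacobiForward] using jacobiSolution_add A B z k₀ u v 1

theorem jacobiSolution_isJacobiSolution {m : ℕ} {A B : ℤ → Matrix (Fin m) (Fin m) ℂ}
    (h : IsJacobiData A B) (z : ℂ) (k₀ : ℤ) (u v : Matrix (Fin m) (Fin m) ℂ) :
    IsJacobiSolution A B z (jacobiSolution A B z k₀ u v) := by
  have hA : ∀ k, IsUnit (A k).det := fun k => (Matrix.isUnit_iff_isUnit_det _).1 (h.posDef k).isUnit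
  intro k
  rcases lt_or_ge k₀ k with hk | hk
  · obtain ⟨n, rfl⟩ : ∃ n : ℕ, k = k₀ + n + 1 := ⟨(k - k₀ - 1).toNat, by omega⟩
    have e0 : k₀ + (n : ℤ) + 1 - 1 = k₀ + n := by ring
    have e1 := jacobiSolution_add A B z k₀ u v n
    have e2 := jacobiSolution_add A B z k₀ u v (n + 1)
    have e3 := jacobiSolution_add A B z k₀ u v (n + 2)
    rw [show k₀ + ((n + 1 : ℕ) : ℤ) = k₀ + n + 1 by push_cast; ring] at e2
    rw [show k₀ + ((n + 2 : ℕ) : ℤ) = k₀ + n + 1 + 1 by push_cast; ring] at e3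
    rw [e0, e1, e2, e3]
    simp only [jacobiForward]
    rw [Matrix.mul_nonsing_inv_cancel_left _ _ (hA _)]
    simp only [sub_mul]
    abel
  · obtain ⟨n, rfl⟩ : ∃ n : ℕ, k = k₀ - n := ⟨(k₀ - k).toNat, by omega⟩
    have e1 := jacobiSolution_sub A B z k₀ u v n
    have e2 := jacobiSolution_sub A B z k₀ u v (n + 1)
    rw [show k₀ - ((n + 1 : ℕ) : ℤ) = k₀ - n - 1 by push_cast; ring] at e2
    have e3 : jacobiSolution A B z k₀ u v (k₀ - n + 1) = (jacobiBackward A B z k₀ u v n).2 := by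
      rcases n with _ | n
      · simpa [jacobiBackward] using jacobiSolution_one A B z k₀ u v
      · rw [show k₀ - ((n + 1 : ℕ) : ℤ) + 1 = k₀ - n by push_cast; ring, jacobiSolution_sub]
        rfl
    rw [e1, e2, e3]
    simp only [jacobiBackward]
    rw [Matrix.mul_nonsing_inv_cancel_left _ _ (hA _)]
    simp only [sub_mul]
    abel

/-- The normalized solution `θ(z, ·, k₀)`: `θ(k₀) = 1`, `θ(k₀ + 1) = 0`. -/
noncomputable def thetaSolution {m : ℕ} (A B : ℤ → Matrix (Fin m) (Fin m) ℂ) (z : ℂ) (k₀ : ℤ) :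
    ℤ → Matrix (Fin m) (Fin m) ℂ :=
  jacobiSolution A B z k₀ 1 0

/-- The normalized solution `φ(z, ·, k₀)`: `φ(k₀) = 0`, `φ(k₀ + 1) = 1`. -/
noncomputable def phiSolution {m : ℕ} (A B : ℤ → Matrix (Fin m) (Fin m) ℂ) (z : ℂ) (k₀ : ℤ) :
    ℤ → Matrix (Fin m) (Fin m) ℂ :=
  jacobiSolution A B z k₀ 0 1

/-- `M` is a Weyl–Titchmarsh matrix for the set of sites `S` (the half-line to the right or to
the left of `k₀`): the solution `ψ = θ - φ A(k₀)⁻¹ M` is square summable over `S`. -/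
def IsWeylMatrix {m : ℕ} (A B : ℤ → Matrix (Fin m) (Fin m) ℂ) (S : Set ℤ) (z : ℂ) (k₀ : ℤ)
    (M : Matrix (Fin m) (Fin m) ℂ) : Prop :=
  Summable fun k : S => ‖thetaSolution A B z k₀ k - phiSolution A B z k₀ k * (A k₀)⁻¹ * M‖ ^ 2

open Classical in
/-- The matrix determined by `IsWeylMatrix`. For bounded Jacobi data, a half-line `S` and
non-real `z` there is exactly one such matrix (limit point case); elsewhere the value is
irrelevant. -/
noncomputable def weylMatrix {m : ℕ} (A B : ℤ → Matrix (Fin m) (Fin m) ℂ) (S : Set ℤ) (z : ℂ)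
    (k₀ : ℤ) : Matrix (Fin m) (Fin m) ℂ :=
  if h : ∃ M, IsWeylMatrix A B S z k₀ M then h.choose else 0

/-- The right half-line Weyl–Titchmarsh matrix `M₊(z, k₀)`. -/
noncomputable def weylPlus {m : ℕ} (A B : ℤ → Matrix (Fin m) (Fin m) ℂ) (z : ℂ) (k₀ : ℤ) :
    Matrix (Fin m) (Fin m) ℂ :=
  weylMatrix A B (Set.Ioi k₀) z k₀

/-- The left half-line Weyl–Titchmarsh matrix `M₋(z, k₀)`. -/
noncomputable def weylMinus {m : ℕ} (A B : ℤ → Matrix (Fin m) (Fin m) ℂ) (z : ℂ) (k₀ : ℤ) :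
    Matrix (Fin m) (Fin m) ℂ :=
  weylMatrix A B (Set.Iio k₀) z k₀

/-- The filter `|z| → ∞` along the ray `arg z = α`. -/
noncomputable def rayAtInfinity (α : ℝ) : Filter ℂ :=
  Bornology.cobounded ℂ ⊓ Filter.principal {z : ℂ | z.arg = α}

/-!
For `|z|` larger than twice the bound on the coefficients, solving the half-line Jacobi equation
for `ψ(n)` with a given boundary value is a fixed point problem for a contraction of the bounded
sequences. So there is a unique bounded solution, it decays geometrically, and bounded and square
summable solutions coincide. Hence `M₊ = B(k₀) - W` and `M₋ = W - z`, where `W = b₀ + a₀ v₁` for the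
bounded solution `v` with `v₀ = 1` on the half-line to the right or to the left of `k₀`, with
coefficients `a₀, a₁, …` and `b₀, b₁, …` numbered from `k₀` outwards.

As `|z| → ∞` in any direction, `W → b₀` and `z (W - b₀) → a₀²`, which determines `b₀`, then `a₀` as
the positive square root. Shifting the half-line by one site gives the continued fraction
`W = b₀ + a₀ (z - W₁)⁻¹ a₀`, and as `z - W₁` has order `z`, two Weyl functions that agree up to
`O(|z|^(-N))` have shifts that agree up to `O(|z|^(-N + 2))`. The theorem follows by induction.
-/

open Filter Topology Bornology

section Recurrence

variable {𝕜 R : Type*} [Ring R] [SMul 𝕜 R] {a b v w : ℕ → R} {z : 𝕜}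

/-- The Jacobi difference expression of the sequence `v` on the half-line `ℕ`, evaluated at the
site `n + 1`. There is no equation at the boundary site `0`. -/
def halfLineJacobi (a b v : ℕ → R) (n : ℕ) : R :=
  a n * v n + b (n + 1) * v (n + 1) + a (n + 1) * v (n + 2)

/-- `v` solves the Jacobi equation with spectral parameter `z` at every site `n + 1` of the
half-line `ℕ`. -/
def IsHalfLineSolution (a b : ℕ → R) (z : 𝕜) (v : ℕ → R) : Prop :=
  ∀ n, halfLineJacobi a b v n = z • v (n + 1)

theorem halfLineJacobi_sub (a b v w : ℕ → R) (n : ℕ) :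
    halfLineJacobi a b (v - w) n = halfLineJacobi a b v n - halfLineJacobi a b w n := by
  simp only [halfLineJacobi, Pi.sub_apply, mul_sub]
  abel

theorem halfLineJacobi_mul_const (a b v : ℕ → R) (x : R) (n : ℕ) :
    halfLineJacobi a b (fun n => v n * x) n = halfLineJacobi a b v n * x := by
  simp only [halfLineJacobi, add_mul, mul_assoc]

namespace IsHalfLineSolution

theorem shift (hv : IsHalfLineSolution a b z v) (k : ℕ) :
    IsHalfLineSolution (fun n => a (n + k)) (fun n => b (n + k)) z (fun n => v (n + k)) := by
  intro n
  simpa only [halfLineJacobi, add_right_comm] using hv (n + k)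

theorem mul_const [IsScalarTower 𝕜 R R] (hv : IsHalfLineSolution a b z v) (x : R) :
    IsHalfLineSolution a b z (fun n => v n * x) := fun n => by
  rw [halfLineJacobi_mul_const, hv, smul_mul_assoc]

theorem eq_of_eq_zero_of_eq_one (ha : ∀ n, IsUnit (a n)) (hv : IsHalfLineSolution a b z v)
    (hw : IsHalfLineSolution a b z w) (h₀ : v 0 = w 0) (h₁ : v 1 = w 1) (n : ℕ) : v n = w n := by
  induction n using Nat.twoStepInduction with
  | zero => exact h₀
  | one => exact h₁
  | more n ih₀ ih₁ =>
    have heq : halfLineJacobi a b v n = halfLineJacobi a b w n := by rw [hv, hw, ih₁]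
    simp only [halfLineJacobi, ih₀, ih₁, add_right_inj] at heq
    exact (ha (n + 1)).mul_left_cancel heq

end IsHalfLineSolution

end Recurrence

theorem IsHalfLineSolution.sub {𝕜 R : Type*} [Ring R] [DistribSMul 𝕜 R]
    {a b v w : ℕ → R} {z : 𝕜} (hv : IsHalfLineSolution a b z v)
    (hw : IsHalfLineSolution a b z w) : IsHalfLineSolution a b z (v - w) := fun n => by
  rw [halfLineJacobi_sub, hv, hw, Pi.sub_apply, smul_sub]

section BoundedSolutions

variable {𝕜 R : Type*} [NormedField 𝕜] [NormedRing R] {a b v w : ℕ → R} {C : ℝ} {z : 𝕜}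

theorem norm_halfLineJacobi_le (h : ∀ n, ‖a n‖ + ‖b n‖ ≤ C) {D : ℝ} (hv : ∀ n, ‖v n‖ ≤ D)
    (n : ℕ) : ‖halfLineJacobi a b v n‖ ≤ 2 * C * D := by
  have hD : 0 ≤ D := (norm_nonneg _).trans (hv 0)
  calc ‖halfLineJacobi a b v n‖
      ≤ ‖a n‖ * ‖v n‖ + ‖b (n + 1)‖ * ‖v (n + 1)‖ + ‖a (n + 1)‖ * ‖v (n + 2)‖ :=
        norm_add₃_le.trans (by gcongr <;> exact norm_mul_le _ _)
    _ ≤ ‖a n‖ * D + ‖b (n + 1)‖ * D + ‖a (n + 1)‖ * D := by gcongr <;> exact hv _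
    _ = (‖a n‖ + (‖a (n + 1)‖ + ‖b (n + 1)‖)) * D := by ring
    _ ≤ (C + C) * D := by
        gcongr
        · exact (le_add_of_nonneg_right (norm_nonneg _)).trans (h n)
        · exact h (n + 1)
    _ = 2 * C * D := by ring

theorem coeffBound_nonneg (h : ∀ n, ‖a n‖ + ‖b n‖ ≤ C) : 0 ≤ C :=
  (add_nonneg (norm_nonneg _) (norm_nonneg _)).trans (h 0)

theorem two_mul_coeffBound_div_norm_nonneg (h : ∀ n, ‖a n‖ + ‖b n‖ ≤ C) (z : 𝕜) :
    0 ≤ 2 * C / ‖z‖ :=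
  div_nonneg (mul_nonneg zero_le_two (coeffBound_nonneg h)) (norm_nonneg z)

theorem ne_zero_of_two_mul_coeffBound_lt_norm (h : ∀ n, ‖a n‖ + ‖b n‖ ≤ C)
    (hz : 2 * C < ‖z‖) : z ≠ 0 :=
  norm_pos_iff.1 <| (mul_nonneg zero_le_two (coeffBound_nonneg h)).trans_lt hz

theorem two_mul_coeffBound_div_norm_lt_one (h : ∀ n, ‖a n‖ + ‖b n‖ ≤ C) (hz : 2 * C < ‖z‖) :
    2 * C / ‖z‖ < 1 :=
  (div_lt_one (norm_pos_iff.2 (ne_zero_of_two_mul_coeffBound_lt_norm h hz))).2 hz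

variable [NormedAlgebra 𝕜 R]

theorem norm_inv_smul_halfLineJacobi_le (h : ∀ n, ‖a n‖ + ‖b n‖ ≤ C) {D : ℝ}
    (hv : ∀ n, ‖v n‖ ≤ D) (z : 𝕜) (n : ℕ) :
    ‖z⁻¹ • halfLineJacobi a b v n‖ ≤ 2 * C / ‖z‖ * D := by
  rw [norm_smul, norm_inv, div_mul_eq_mul_div, div_eq_inv_mul]
  gcongr
  exact norm_halfLineJacobi_le h hv n

namespace IsHalfLineSolution

theorem norm_succ_le_of_forall_norm_le (h : ∀ n, ‖a n‖ + ‖b n‖ ≤ C) (hz : 2 * C < ‖z‖)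
    (hv : IsHalfLineSolution a b z v) {D : ℝ} (hD : ∀ n, ‖v n‖ ≤ D) (n : ℕ) :
    ‖v (n + 1)‖ ≤ 2 * C / ‖z‖ * D := by
  rw [← inv_smul_smul₀ (ne_zero_of_two_mul_coeffBound_lt_norm h hz) (v (n + 1)), ← hv n]
  exact norm_inv_smul_halfLineJacobi_le h hD z n

/-- A maximum principle: away from the boundary site `0`, the norm is at most
`2 * C / ‖z‖ < 1` times its supremum. -/
theorem norm_le_norm_zero (h : ∀ n, ‖a n‖ + ‖b n‖ ≤ C) (hz : 2 * C < ‖z‖)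
    (hv : IsHalfLineSolution a b z v) (hbdd : BddAbove (Set.range fun n => ‖v n‖)) (n : ℕ) :
    ‖v n‖ ≤ ‖v 0‖ := by
  set S := ⨆ n, ‖v n‖
  have hle : ∀ n, ‖v n‖ ≤ S := le_ciSup hbdd
  have hS : S ≤ max ‖v 0‖ (2 * C / ‖z‖ * S) := ciSup_le fun
    | 0 => le_max_left _ _
    | n + 1 => (hv.norm_succ_le_of_forall_norm_le h hz hle n).trans (le_max_right _ _)
  refine (hle n).trans ((le_max_iff.1 hS).elim id fun hS' => ?_)
  have hq := two_mul_coeffBound_div_norm_lt_one h hz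
  have hS₀ : S ≤ 0 := by nlinarith
  exact hS₀.trans (norm_nonneg _)

theorem norm_succ_le (h : ∀ n, ‖a n‖ + ‖b n‖ ≤ C) (hz : 2 * C < ‖z‖)
    (hv : IsHalfLineSolution a b z v) (hbdd : BddAbove (Set.range fun n => ‖v n‖)) (n : ℕ) :
    ‖v (n + 1)‖ ≤ 2 * C / ‖z‖ * ‖v n‖ := by
  have hshift : ∀ k, ‖v (k + n)‖ ≤ ‖v n‖ := fun k => by
    simpa only [zero_add] using (hv.shift n).norm_le_norm_zero (fun k => h (k + n)) hz
      (hbdd.mono (Set.range_comp_subset_range (· + n) fun n => ‖v n‖)) k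
  simpa only [zero_add, add_comm 1] using
    (hv.shift n).norm_succ_le_of_forall_norm_le (fun k => h (k + n)) hz hshift 0

theorem norm_le_pow_mul (h : ∀ n, ‖a n‖ + ‖b n‖ ≤ C) (hz : 2 * C < ‖z‖)
    (hv : IsHalfLineSolution a b z v) (hbdd : BddAbove (Set.range fun n => ‖v n‖)) (n : ℕ) :
    ‖v n‖ ≤ (2 * C / ‖z‖) ^ n * ‖v 0‖ :=
  le_geom (u := fun n => ‖v n‖) (two_mul_coeffBound_div_norm_nonneg h z) n fun k _ =>
    hv.norm_succ_le h hz hbdd k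

theorem summable_norm_sq (h : ∀ n, ‖a n‖ + ‖b n‖ ≤ C) (hz : 2 * C < ‖z‖)
    (hv : IsHalfLineSolution a b z v) (hbdd : BddAbove (Set.range fun n => ‖v n‖)) :
    Summable fun n => ‖v n‖ ^ 2 := by
  have hgeom : Summable fun n : ℕ => ((2 * C / ‖z‖) ^ 2) ^ n * ‖v 0‖ ^ 2 :=
    (summable_geometric_of_lt_one (sq_nonneg _) (pow_lt_one₀
      (two_mul_coeffBound_div_norm_nonneg h z) (two_mul_coeffBound_div_norm_lt_one h hz)
      two_ne_zero)).mul_right _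
  refine hgeom.of_nonneg_of_le (fun n => sq_nonneg _) fun n => ?_
  rw [pow_right_comm, ← mul_pow]
  gcongr
  exact hv.norm_le_pow_mul h hz hbdd n

theorem eq_of_eq_zero (h : ∀ n, ‖a n‖ + ‖b n‖ ≤ C) (hz : 2 * C < ‖z‖)
    (hv : IsHalfLineSolution a b z v) (hw : IsHalfLineSolution a b z w)
    (hvb : BddAbove (Set.range fun n => ‖v n‖)) (hwb : BddAbove (Set.range fun n => ‖w n‖))
    (h₀ : v 0 = w 0) : v = w := by
  have hbdd : BddAbove (Set.range fun n => ‖(v - w) n‖) :=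
    (hvb.range_add hwb).range_mono _ fun n => norm_sub_le (v n) (w n)
  funext n
  have hn := (hv.sub hw).norm_le_norm_zero h hz hbdd n
  rw [Pi.sub_apply, Pi.sub_apply, h₀, sub_self, norm_zero] at hn
  exact sub_eq_zero.1 (norm_le_zero_iff.1 hn)

end IsHalfLineSolution

/-- The affine map whose fixed points are the solutions of the half-line Jacobi equation with
boundary value `c` at the site `0`. -/
def jacobiIteration (a b : ℕ → R) (z : 𝕜) (c : R) (v : ℕ → R) : ℕ → R
  | 0 => c
  | n + 1 => z⁻¹ • halfLineJacobi a b v n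

theorem norm_jacobiIteration_le (h : ∀ n, ‖a n‖ + ‖b n‖ ≤ C) {D : ℝ} (hv : ∀ n, ‖v n‖ ≤ D)
    (z : 𝕜) (c : R) (n : ℕ) : ‖jacobiIteration a b z c v n‖ ≤ max ‖c‖ (2 * C / ‖z‖ * D) :=
  match n with
  | 0 => le_max_left _ _
  | n + 1 => (norm_inv_smul_halfLineJacobi_le h hv z n).trans (le_max_right _ _)

theorem dist_jacobiIteration_le (h : ∀ n, ‖a n‖ + ‖b n‖ ≤ C) {D : ℝ}
    (hD : ∀ n, dist (v n) (w n) ≤ D) (z : 𝕜) (c : R) (n : ℕ) :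
    dist (jacobiIteration a b z c v n) (jacobiIteration a b z c w n) ≤ 2 * C / ‖z‖ * D := by
  simp only [dist_eq_norm] at hD ⊢
  cases n with
  | zero =>
    have hD₀ : 0 ≤ D := (norm_nonneg _).trans (hD 0)
    have hC := coeffBound_nonneg h
    simp only [jacobiIteration, sub_self, norm_zero]
    positivity
  | succ n =>
    simp only [jacobiIteration, ← smul_sub, ← halfLineJacobi_sub]
    exact norm_inv_smul_halfLineJacobi_le h hD z n

theorem exists_isHalfLineSolution_bddAbove [CompleteSpace R] (h : ∀ n, ‖a n‖ + ‖b n‖ ≤ C)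
    (hz : 2 * C < ‖z‖) (c : R) :
    ∃ v, IsHalfLineSolution a b z v ∧ v 0 = c ∧ BddAbove (Set.range fun n => ‖v n‖) := by
  let T (v : BoundedContinuousFunction ℕ R) : BoundedContinuousFunction ℕ R :=
    .ofNormedAddCommGroupDiscrete (jacobiIteration a b z c v) _
      (norm_jacobiIteration_le h v.norm_coe_le_norm z c)
  have hT : ContractingWith (2 * C / ‖z‖).toNNReal T := by
    refine ⟨Real.toNNReal_lt_one.2 (two_mul_coeffBound_div_norm_lt_one h hz),
      .of_dist_le' fun v w => ?_⟩
    have hC := coeffBound_nonneg h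
    exact (BoundedContinuousFunction.dist_le (by positivity)).2 <|
      dist_jacobiIteration_le h (fun n => v.dist_coe_le_dist n) z c
  let v := hT.fixedPoint T
  have hv : ∀ n, jacobiIteration a b z c v n = v n := DFunLike.congr_fun hT.fixedPoint_isFixedPt
  refine ⟨v, fun n => ?_, (hv 0).symm, ‖v‖, Set.forall_mem_range.2 v.norm_coe_le_norm⟩
  rw [← hv (n + 1), jacobiIteration,
    smul_inv_smul₀ (ne_zero_of_two_mul_coeffBound_lt_norm h hz)]

end BoundedSolutions

section WeylFunction

variable {𝕜 R : Type*} [NormedField 𝕜] [NormedRing R] [NormedAlgebra 𝕜 R]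
  {a b : ℕ → R} {C : ℝ} {z : 𝕜}

/-- The half-line Weyl solution: the bounded solution normalized to `1` at the boundary. It exists
and is unique for large `z`. -/
structure IsHalfLineWeylSolution (a b : ℕ → R) (z : 𝕜) (v : ℕ → R) : Prop where
  isHalfLineSolution : IsHalfLineSolution a b z v
  apply_zero : v 0 = 1
  bddAbove : BddAbove (Set.range fun n => ‖v n‖)

open Classical in
/-- The half-line Weyl solution as a function of `z`, with value `0` where there is none. -/
noncomputable def halfLineWeylSolution (a b : ℕ → R) (z : 𝕜) : ℕ → R :=
  if h : ∃ v, IsHalfLineWeylSolution a b z v then h.choose else 0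

/-- The half-line Weyl function `b 0 + a 0 * v 1`, where `v` is the Weyl solution. Then
`(halfLineWeylFunction a b z - z)⁻¹` is the Weyl function `⟨δ₀, (H - z)⁻¹ δ₀⟩` of the half-line
Jacobi operator `H` with coefficients `a`, `b`. -/
noncomputable def halfLineWeylFunction (a b : ℕ → R) (z : 𝕜) : R :=
  b 0 + a 0 * halfLineWeylSolution a b z 1

theorem IsHalfLineSolution.summable_norm_sq_iff_bddAbove {v : ℕ → R}
    (h : ∀ n, ‖a n‖ + ‖b n‖ ≤ C) (hz : 2 * C < ‖z‖) (hv : IsHalfLineSolution a b z v) :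
    Summable (fun n => ‖v n‖ ^ 2) ↔ BddAbove (Set.range fun n => ‖v n‖) := by
  refine ⟨fun hs => ?_, hv.summable_norm_sq h hz⟩
  have hlim : Tendsto (fun n => ‖v n‖) atTop (𝓝 0) := by
    simpa only [Real.sqrt_sq (norm_nonneg _), Real.sqrt_zero] using hs.tendsto_atTop_zero.sqrt
  exact hlim.bddAbove_range

variable [CompleteSpace R]

theorem isHalfLineWeylSolution_halfLineWeylSolution (h : ∀ n, ‖a n‖ + ‖b n‖ ≤ C)
    (hz : 2 * C < ‖z‖) : IsHalfLineWeylSolution a b z (halfLineWeylSolution a b z) := by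
  have hex : ∃ v, IsHalfLineWeylSolution a b z v :=
    let ⟨v, hv, hv₀, hvb⟩ := exists_isHalfLineSolution_bddAbove h hz 1
    ⟨v, hv, hv₀, hvb⟩
  rw [halfLineWeylSolution, dif_pos hex]
  exact hex.choose_spec

theorem IsHalfLineSolution.eq_halfLineWeylSolution_mul {v : ℕ → R}
    (h : ∀ n, ‖a n‖ + ‖b n‖ ≤ C) (hz : 2 * C < ‖z‖) (hv : IsHalfLineSolution a b z v)
    (hbdd : BddAbove (Set.range fun n => ‖v n‖)) :
    v = fun n => halfLineWeylSolution a b z n * v 0 := by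
  obtain ⟨hu, hu₀, K, hK⟩ := isHalfLineWeylSolution_halfLineWeylSolution h hz
  refine hv.eq_of_eq_zero h hz (hu.mul_const (v 0)) hbdd ?_ (by rw [hu₀, one_mul])
  refine ⟨K * ‖v 0‖, Set.forall_mem_range.2 fun n => (norm_mul_le _ _).trans ?_⟩
  gcongr
  exact hK ⟨n, rfl⟩

theorem IsHalfLineSolution.summable_norm_sq_iff_eq_halfLineWeylFunction {v : ℕ → R}
    (h : ∀ n, ‖a n‖ + ‖b n‖ ≤ C) (ha : ∀ n, IsUnit (a n)) (hz : 2 * C < ‖z‖)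
    (hv : IsHalfLineSolution a b z v) (hv₀ : v 0 = 1) :
    Summable (fun n => ‖v n‖ ^ 2) ↔ b 0 + a 0 * v 1 = halfLineWeylFunction a b z := by
  rw [hv.summable_norm_sq_iff_bddAbove h hz, halfLineWeylFunction, add_right_inj,
    (ha 0).mul_right_inj]
  constructor
  · intro hbdd
    simpa only [hv₀, mul_one] using congrFun (hv.eq_halfLineWeylSolution_mul h hz hbdd) 1
  · intro hv₁
    obtain ⟨hu, hu₀, hub⟩ := isHalfLineWeylSolution_halfLineWeylSolution h hz
    rwa [funext (hv.eq_of_eq_zero_of_eq_one ha hu (hv₀.trans hu₀.symm) hv₁)]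

/-- The Riccati equation: as `W = b 0 + a 0 * v 1` for the Weyl solution `v`, this is a step
`W = b 0 + a 0 * (z - W₁)⁻¹ * a 0` of the continued fraction, free of inverses. -/
theorem smul_one_sub_halfLineWeylFunction_shift_mul (h : ∀ n, ‖a n‖ + ‖b n‖ ≤ C)
    (hz : 2 * C < ‖z‖) :
    (z • 1 - halfLineWeylFunction (fun n => a (n + 1)) (fun n => b (n + 1)) z)
      * halfLineWeylSolution a b z 1 = a 0 := by
  obtain ⟨hv, hv₀, hvb⟩ := isHalfLineWeylSolution_halfLineWeylSolution h hz
  set v := halfLineWeylSolution a b z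
  have hv₂ : v 2 = halfLineWeylSolution (fun n => a (n + 1)) (fun n => b (n + 1)) z 1 * v 1 :=
    congrFun ((hv.shift 1).eq_halfLineWeylSolution_mul (fun n => h (n + 1)) hz
      (hvb.mono (Set.range_comp_subset_range (· + 1) fun n => ‖v n‖))) 1
  have hsite : a 0 * 1 + b 1 * v 1 + a 1 * v 2 = z • v 1 := hv₀ ▸ hv 0
  rw [halfLineWeylFunction, sub_mul, smul_mul_assoc, one_mul, ← hsite, add_mul, mul_assoc, ← hv₂,
    mul_one]
  simp only [zero_add]
  abel

theorem eventually_two_mul_lt_norm_cobounded (C : ℝ) : ∀ᶠ z : 𝕜 in cobounded 𝕜, 2 * C < ‖z‖ :=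
  tendsto_norm_cobounded_atTop.eventually_gt_atTop (2 * C)

theorem tendsto_halfLineWeylSolution_succ (h : ∀ n, ‖a n‖ + ‖b n‖ ≤ C) (n : ℕ) :
    Tendsto (fun z : 𝕜 => halfLineWeylSolution a b z (n + 1)) (cobounded 𝕜) (𝓝 0) := by
  have hlim : Tendsto (fun z : 𝕜 => 2 * C / ‖z‖ * ‖(1 : R)‖) (cobounded 𝕜) (𝓝 0) := by
    simpa only [zero_mul] using
      (tendsto_norm_cobounded_atTop.const_div_atTop (2 * C)).mul_const ‖(1 : R)‖
  refine squeeze_zero_norm' ?_ hlim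
  filter_upwards [eventually_two_mul_lt_norm_cobounded C] with z hz
  obtain ⟨hv, hv₀, hvb⟩ := isHalfLineWeylSolution_halfLineWeylSolution h hz
  refine hv.norm_succ_le_of_forall_norm_le h hz (fun k => ?_) n
  exact hv₀ ▸ hv.norm_le_norm_zero h hz hvb k

theorem tendsto_halfLineWeylFunction (h : ∀ n, ‖a n‖ + ‖b n‖ ≤ C) :
    Tendsto (halfLineWeylFunction a b : 𝕜 → R) (cobounded 𝕜) (𝓝 (b 0)) := by
  have hlim := ((tendsto_halfLineWeylSolution_succ (𝕜 := 𝕜) h 0).const_mul (a 0)).const_add (b 0)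
  rwa [mul_zero, add_zero] at hlim

theorem tendsto_smul_halfLineWeylFunction_sub (h : ∀ n, ‖a n‖ + ‖b n‖ ≤ C) :
    Tendsto (fun z : 𝕜 => z • (halfLineWeylFunction a b z - b 0)) (cobounded 𝕜)
      (𝓝 (a 0 * a 0)) := by
  have hlim : Tendsto (fun z : 𝕜 => a 0 * (a 0 + b 1 * halfLineWeylSolution a b z 1
      + a 1 * halfLineWeylSolution a b z 2)) (cobounded 𝕜) (𝓝 (a 0 * a 0)) := by
    simpa only [mul_zero, add_zero] using
      ((((tendsto_halfLineWeylSolution_succ h 0).const_mul (b 1)).const_add (a 0)).add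
        ((tendsto_halfLineWeylSolution_succ h 1).const_mul (a 1))).const_mul (a 0)
  refine hlim.congr' ?_
  filter_upwards [eventually_two_mul_lt_norm_cobounded C] with z hz
  obtain ⟨hv, hv₀, -⟩ := isHalfLineWeylSolution_halfLineWeylSolution h hz
  have hsite := hv 0
  simp only [halfLineJacobi, hv₀, mul_one, zero_add] at hsite
  rw [halfLineWeylFunction, add_sub_cancel_left, ← mul_smul_comm, ← hsite]

end WeylFunction

section LocalUniqueness

open Asymptotics

theorem tendsto_zero_of_isBigO_norm_zpow_neg {𝕜 E : Type*} [NormedAddCommGroup 𝕜]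
    [NormedAddCommGroup E] {l : Filter 𝕜} (hl : l ≤ cobounded 𝕜) {f : 𝕜 → E} {n : ℤ} (hn : 0 < n)
    (hf : f =O[l] fun z => ‖z‖ ^ (-n)) : Tendsto f l (𝓝 0) :=
  hf.trans_tendsto <|
    (tendsto_zpow_atTop_zero (neg_neg_of_pos hn)).comp (tendsto_norm_cobounded_atTop.mono_left hl)

theorem mul_sub_mul_inverse_mul_eq_sub {R : Type*} [Ring R] {a p₁ p₂ v₁ v₂ : R} (ha : IsUnit a)
    (hp₂ : IsUnit p₂) (h₁ : p₁ * v₁ = a) (h₂ : p₂ * v₂ = a) :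
    p₁ * (v₁ - v₂) * Ring.inverse a * p₂ = p₂ - p₁ := by
  have hinv : v₂ * Ring.inverse a * p₂ = 1 := by
    refine hp₂.mul_left_cancel ?_
    rw [← mul_assoc, ← mul_assoc, h₂, Ring.mul_inverse_cancel a ha, one_mul, mul_one]
  rw [mul_sub, sub_mul, sub_mul, h₁, Ring.mul_inverse_cancel a ha, one_mul, mul_assoc p₁,
    mul_assoc p₁, hinv, mul_one]

section NormedAlgebra

variable {𝕜 R : Type*} [NormedField 𝕜] [NormedRing R] [NormedAlgebra 𝕜 R]

theorem isBigO_smul_one_sub {f : 𝕜 → R} {c : R} (hf : Tendsto f (cobounded 𝕜) (𝓝 c)) :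
    (fun z => z • (1 : R) - f z) =O[cobounded 𝕜] fun z => ‖z‖ ^ (1 : ℤ) := by
  simp only [zpow_one]
  have hid : (fun z : 𝕜 => z • (1 : R)) =O[cobounded 𝕜] fun z => ‖z‖ := by
    simpa using (isBigO_refl (fun z : 𝕜 => z) _).norm_right.smul
      (isBigO_const_one ℝ (1 : R) (cobounded 𝕜))
  have hone : (fun _ => (1 : ℝ)) =O[cobounded 𝕜] fun z : 𝕜 => ‖z‖ :=
    (isLittleO_const_id_cobounded (1 : ℝ)).isBigO.norm_right
  exact hid.sub ((hf.isBigO_one ℝ).trans hone)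

variable [CompleteSpace R]

theorem eventually_isUnit_smul_one_sub {f : 𝕜 → R} {c : R} (hf : Tendsto f (cobounded 𝕜) (𝓝 c)) :
    ∀ᶠ z in cobounded 𝕜, IsUnit (z • 1 - f z) := by
  have hbdd : ∀ᶠ z in cobounded 𝕜, ‖f z‖ * ‖(1 : R)‖ < ‖c‖ * ‖(1 : R)‖ + 1 :=
    (hf.norm.mul_const _).eventually_lt_const (lt_add_one _)
  filter_upwards [hbdd, tendsto_norm_cobounded_atTop.eventually_ge_atTop _] with z hz hz'
  rw [← Algebra.algebraMap_eq_smul_one]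
  exact spectrum.mem_resolventSet_of_norm_lt_mul (hz.trans_le hz')

variable {l : Filter 𝕜} {a₁ b₁ a₂ b₂ : ℕ → R} {C₁ C₂ : ℝ} {N : ℤ}

theorem diagonal_zero_eq_of_isBigO [l.NeBot] (hl : l ≤ cobounded 𝕜)
    (h₁ : ∀ n, ‖a₁ n‖ + ‖b₁ n‖ ≤ C₁) (h₂ : ∀ n, ‖a₂ n‖ + ‖b₂ n‖ ≤ C₂) (hN : 0 < N)
    (hO : (fun z => halfLineWeylFunction a₁ b₁ z - halfLineWeylFunction a₂ b₂ z)
      =O[l] fun z => ‖z‖ ^ (-N)) : b₁ 0 = b₂ 0 :=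
  sub_eq_zero.1 <| tendsto_nhds_unique
    (((tendsto_halfLineWeylFunction h₁).sub (tendsto_halfLineWeylFunction h₂)).mono_left hl)
    (tendsto_zero_of_isBigO_norm_zpow_neg hl hN hO)

theorem offDiagonal_zero_mul_self_eq_of_isBigO [l.NeBot] (hl : l ≤ cobounded 𝕜)
    (h₁ : ∀ n, ‖a₁ n‖ + ‖b₁ n‖ ≤ C₁) (h₂ : ∀ n, ‖a₂ n‖ + ‖b₂ n‖ ≤ C₂) (hN : 1 < N)
    (hO : (fun z => halfLineWeylFunction a₁ b₁ z - halfLineWeylFunction a₂ b₂ z)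
      =O[l] fun z => ‖z‖ ^ (-N)) : a₁ 0 * a₁ 0 = a₂ 0 * a₂ 0 := by
  have hb : b₁ 0 = b₂ 0 := diagonal_zero_eq_of_isBigO hl h₁ h₂ (zero_lt_one.trans hN) hO
  refine sub_eq_zero.1 <| tendsto_nhds_unique
    (((tendsto_smul_halfLineWeylFunction_sub h₁).sub
      (tendsto_smul_halfLineWeylFunction_sub h₂)).mono_left hl)
    (tendsto_zero_of_isBigO_norm_zpow_neg hl (sub_pos.2 hN) ?_)
  have hid : (fun z : 𝕜 => z) =O[l] fun z => ‖z‖ ^ (1 : ℤ) := by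
    simpa only [zpow_one] using (isBigO_refl (fun z : 𝕜 => z) l).norm_right
  refine (hid.smul hO).congr' (.of_forall fun z => ?_) ?_
  · dsimp only
    rw [← smul_sub, hb, sub_sub_sub_cancel_right]
  · filter_upwards [hl (eventually_ne_cobounded 0)] with z hz
    rw [smul_eq_mul, ← zpow_add₀ (norm_ne_zero_iff.2 hz), ← sub_eq_add_neg, neg_sub]

theorem isBigO_halfLineWeylFunction_shift_sub (hl : l ≤ cobounded 𝕜)
    (h₁ : ∀ n, ‖a₁ n‖ + ‖b₁ n‖ ≤ C₁) (h₂ : ∀ n, ‖a₂ n‖ + ‖b₂ n‖ ≤ C₂) (hu : IsUnit (a₁ 0))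
    (ha : a₁ 0 = a₂ 0) (hb : b₁ 0 = b₂ 0)
    (hO : (fun z => halfLineWeylFunction a₁ b₁ z - halfLineWeylFunction a₂ b₂ z)
      =O[l] fun z => ‖z‖ ^ (-N)) :
    (fun z => halfLineWeylFunction (fun n => a₁ (n + 1)) (fun n => b₁ (n + 1)) z
      - halfLineWeylFunction (fun n => a₂ (n + 1)) (fun n => b₂ (n + 1)) z)
      =O[l] fun z => ‖z‖ ^ (-(N - 2)) := by
  have ht₁ := tendsto_halfLineWeylFunction (𝕜 := 𝕜) fun n => h₁ (n + 1)
  have ht₂ := tendsto_halfLineWeylFunction (𝕜 := 𝕜) fun n => h₂ (n + 1)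
  have hv : (fun z => halfLineWeylSolution a₁ b₁ z 1 - halfLineWeylSolution a₂ b₂ z 1)
      =O[l] fun z => ‖z‖ ^ (-N) := by
    refine ((isBigO_const_one ℝ (Ring.inverse (a₁ 0)) l).mul hO).congr (fun z => ?_)
      fun z => one_mul _
    rw [halfLineWeylFunction, halfLineWeylFunction, ← ha, ← hb, add_sub_add_left_eq_sub, ← mul_sub,
      Ring.inverse_mul_cancel_left _ _ hu]
  refine ((((isBigO_smul_one_sub ht₁).mono hl).mul hv).mul
    (isBigO_const_one ℝ (Ring.inverse (a₁ 0)) l) |>.mul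
      ((isBigO_smul_one_sub ht₂).mono hl)).congr' ?_ ?_
  · filter_upwards [hl (eventually_two_mul_lt_norm_cobounded C₁),
      hl (eventually_two_mul_lt_norm_cobounded C₂),
      hl (eventually_isUnit_smul_one_sub ht₂)] with z hz₁ hz₂ hp₂
    rw [mul_sub_mul_inverse_mul_eq_sub hu hp₂
      (smul_one_sub_halfLineWeylFunction_shift_mul h₁ hz₁)
      (ha ▸ smul_one_sub_halfLineWeylFunction_shift_mul h₂ hz₂), sub_sub_sub_cancel_left]
  · filter_upwards [hl (eventually_ne_cobounded 0)] with z hz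
    rw [mul_one, ← zpow_add₀ (norm_ne_zero_iff.2 hz), ← zpow_add₀ (norm_ne_zero_iff.2 hz)]
    congr 1
    ring

end NormedAlgebra

section CStarAlgebra

variable {R : Type*} [CStarAlgebra R] [PartialOrder R] [StarOrderedRing R] {l : Filter ℂ} [l.NeBot]
  {a₁ b₁ a₂ b₂ : ℕ → R} {C₁ C₂ : ℝ} {N : ℤ}

theorem offDiagonal_zero_eq_of_isBigO (hl : l ≤ cobounded ℂ)
    (ha₁ : 0 ≤ a₁ 0) (ha₂ : 0 ≤ a₂ 0)
    (h₁ : ∀ n, ‖a₁ n‖ + ‖b₁ n‖ ≤ C₁) (h₂ : ∀ n, ‖a₂ n‖ + ‖b₂ n‖ ≤ C₂) (hN : 1 < N)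
    (hO : (fun z => halfLineWeylFunction a₁ b₁ z - halfLineWeylFunction a₂ b₂ z)
      =O[l] fun z => ‖z‖ ^ (-N)) : a₁ 0 = a₂ 0 :=
  (CFC.mul_self_eq_mul_self_iff _ _ ha₁ ha₂).1 <|
    offDiagonal_zero_mul_self_eq_of_isBigO hl h₁ h₂ hN hO

theorem coeff_eq_of_isBigO_halfLineWeylFunction_sub (hl : l ≤ cobounded ℂ)
    (ha₁ : ∀ n, IsStrictlyPositive (a₁ n)) (ha₂ : ∀ n, IsStrictlyPositive (a₂ n))
    (h₁ : ∀ n, ‖a₁ n‖ + ‖b₁ n‖ ≤ C₁) (h₂ : ∀ n, ‖a₂ n‖ + ‖b₂ n‖ ≤ C₂)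
    (hO : (fun z => halfLineWeylFunction a₁ b₁ z - halfLineWeylFunction a₂ b₂ z)
      =O[l] fun z => ‖z‖ ^ (-N)) (k : ℕ) :
    (2 * k + 1 ≤ N → b₁ k = b₂ k) ∧ (2 * k + 2 ≤ N → a₁ k = a₂ k) := by
  induction k generalizing a₁ b₁ a₂ b₂ N with
  | zero =>
    exact ⟨fun hN => diagonal_zero_eq_of_isBigO hl h₁ h₂ hN hO, fun hN =>
      offDiagonal_zero_eq_of_isBigO hl (ha₁ 0).nonneg (ha₂ 0).nonneg h₁ h₂ hN hO⟩
  | succ k ih =>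
    rcases le_or_gt N 1 with hN | hN
    · constructor <;> intro <;> omega
    have hb := diagonal_zero_eq_of_isBigO hl h₁ h₂ (zero_lt_one.trans hN) hO
    have ha := offDiagonal_zero_eq_of_isBigO hl (ha₁ 0).nonneg (ha₂ 0).nonneg h₁ h₂ hN hO
    obtain ⟨ihb, iha⟩ := ih (fun n => ha₁ (n + 1)) (fun n => ha₂ (n + 1)) (fun n => h₁ (n + 1))
      (fun n => h₂ (n + 1))
      (isBigO_halfLineWeylFunction_shift_sub hl h₁ h₂ (ha₁ 0).isUnit ha hb hO)
    exact ⟨fun hk => ihb (by omega), fun hk => iha (by omega)⟩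

end CStarAlgebra

end LocalUniqueness

section JacobiWeyl

variable {m : ℕ} {A B : ℤ → Matrix (Fin m) (Fin m) ℂ} {C : ℝ} {z : ℂ} {k₀ : ℤ}

theorem mul_jacobiForward_succ_snd (hA : ∀ k, IsUnit (A k)) (u v : Matrix (Fin m) (Fin m) ℂ)
    (n : ℕ) : A (k₀ + n + 1) * (jacobiForward A B z k₀ u v (n + 1)).2 =
      (z • 1 - B (k₀ + n + 1)) * (jacobiForward A B z k₀ u v n).2
        - A (k₀ + n) * (jacobiForward A B z k₀ u v n).1 :=
  Matrix.mul_nonsing_inv_cancel_left _ _ ((Matrix.isUnit_iff_isUnit_det _).1 (hA _))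

theorem mul_jacobiBackward_succ_fst (hA : ∀ k, IsUnit (A k)) (u v : Matrix (Fin m) (Fin m) ℂ)
    (n : ℕ) : A (k₀ - n - 1) * (jacobiBackward A B z k₀ u v (n + 1)).1 =
      (z • 1 - B (k₀ - n)) * (jacobiBackward A B z k₀ u v n).1
        - A (k₀ - n) * (jacobiBackward A B z k₀ u v n).2 :=
  Matrix.mul_nonsing_inv_cancel_left _ _ ((Matrix.isUnit_iff_isUnit_det _).1 (hA _))

theorem mul_jacobiSolution_sub_one (hA : ∀ k, IsUnit (A k)) (u v : Matrix (Fin m) (Fin m) ℂ) :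
    A (k₀ - 1) * jacobiSolution A B z k₀ u v (k₀ - 1) = (z • 1 - B k₀) * u - A k₀ * v := by
  have h₁ := jacobiSolution_sub A B z k₀ u v 1
  have hmul := mul_jacobiBackward_succ_fst (B := B) (z := z) (k₀ := k₀) hA u v 0
  rw [Nat.cast_one] at h₁
  rw [Nat.cast_zero, sub_zero] at hmul
  rw [h₁]
  exact hmul

theorem isHalfLineSolution_jacobiSolution_add (hA : ∀ k, IsUnit (A k)) (z : ℂ) (k₀ : ℤ)
    (u v : Matrix (Fin m) (Fin m) ℂ) :
    IsHalfLineSolution (fun n : ℕ => A (k₀ + n)) (fun n : ℕ => B (k₀ + n)) z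
      (fun n : ℕ => jacobiSolution A B z k₀ u v (k₀ + n)) := by
  intro n
  have hmul := mul_jacobiForward_succ_snd (B := B) (z := z) (k₀ := k₀) hA u v n
  have hv₁ : (jacobiForward A B z k₀ u v (n + 1)).1 = (jacobiForward A B z k₀ u v n).2 := rfl
  have hv₂ : (jacobiForward A B z k₀ u v (n + 2)).1 = (jacobiForward A B z k₀ u v (n + 1)).2 := rfl
  simp only [halfLineJacobi, jacobiSolution_add, hv₁, hv₂]
  rw [Nat.cast_add_one, ← add_assoc, hmul, sub_mul, smul_mul_assoc, one_mul]
  abel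

theorem isHalfLineSolution_jacobiSolution_sub (hA : ∀ k, IsUnit (A k)) (z : ℂ) (k₀ : ℤ)
    (u v : Matrix (Fin m) (Fin m) ℂ) :
    IsHalfLineSolution (fun n : ℕ => A (k₀ - 1 - n)) (fun n : ℕ => B (k₀ - n)) z
      (fun n : ℕ => jacobiSolution A B z k₀ u v (k₀ - n)) := by
  intro n
  have hmul := mul_jacobiBackward_succ_fst (B := B) (z := z) (k₀ := k₀) hA u v (n + 1)
  have hv₀ : (jacobiBackward A B z k₀ u v (n + 1)).2 = (jacobiBackward A B z k₀ u v n).1 := rfl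
  simp only [halfLineJacobi, jacobiSolution_sub, sub_right_comm k₀ 1]
  rw [hmul, hv₀, sub_mul, smul_mul_assoc, one_mul, Nat.cast_add_one, ← sub_sub]
  abel

/-- The solution `θ - φ A(k₀)⁻¹ M` whose square summability on a half-line makes `M` a
Weyl–Titchmarsh matrix. -/
noncomputable def weylSolution (A B : ℤ → Matrix (Fin m) (Fin m) ℂ) (z : ℂ) (k₀ : ℤ)
    (M : Matrix (Fin m) (Fin m) ℂ) (k : ℤ) : Matrix (Fin m) (Fin m) ℂ :=
  thetaSolution A B z k₀ k - phiSolution A B z k₀ k * (A k₀)⁻¹ * M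

theorem weylSolution_self (M : Matrix (Fin m) (Fin m) ℂ) : weylSolution A B z k₀ M k₀ = 1 := by
  simp only [weylSolution, thetaSolution, phiSolution, jacobiSolution_zero, zero_mul, sub_zero]

theorem mul_weylSolution_add_one (hA : IsUnit (A k₀)) (M : Matrix (Fin m) (Fin m) ℂ) :
    A k₀ * weylSolution A B z k₀ M (k₀ + 1) = -M := by
  rw [weylSolution, thetaSolution, phiSolution, jacobiSolution_one, jacobiSolution_one, one_mul,
    zero_sub, mul_neg,
    Matrix.mul_nonsing_inv_cancel_left _ _ ((Matrix.isUnit_iff_isUnit_det _).1 hA)]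

theorem mul_weylSolution_sub_one (hA : ∀ k, IsUnit (A k)) (M : Matrix (Fin m) (Fin m) ℂ) :
    A (k₀ - 1) * weylSolution A B z k₀ M (k₀ - 1) = M + z • 1 - B k₀ := by
  rw [weylSolution, thetaSolution, phiSolution, mul_assoc, mul_sub, ← mul_assoc,
    mul_jacobiSolution_sub_one hA, mul_jacobiSolution_sub_one hA, mul_zero, mul_zero, mul_one,
    mul_one, sub_zero, zero_sub, neg_mul, sub_neg_eq_add,
    Matrix.mul_nonsing_inv_cancel_left _ _ ((Matrix.isUnit_iff_isUnit_det _).1 (hA k₀))]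
  abel

theorem isHalfLineSolution_weylSolution_add (hA : ∀ k, IsUnit (A k)) (z : ℂ) (k₀ : ℤ)
    (M : Matrix (Fin m) (Fin m) ℂ) :
    IsHalfLineSolution (fun n : ℕ => A (k₀ + n)) (fun n : ℕ => B (k₀ + n)) z
      (fun n : ℕ => weylSolution A B z k₀ M (k₀ + n)) := by
  simp only [weylSolution, mul_assoc]
  exact (isHalfLineSolution_jacobiSolution_add hA z k₀ 1 0).sub
      ((isHalfLineSolution_jacobiSolution_add hA z k₀ 0 1).mul_const ((A k₀)⁻¹ * M))

theorem isHalfLineSolution_weylSolution_sub (hA : ∀ k, IsUnit (A k)) (z : ℂ) (k₀ : ℤ)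
    (M : Matrix (Fin m) (Fin m) ℂ) :
    IsHalfLineSolution (fun n : ℕ => A (k₀ - 1 - n)) (fun n : ℕ => B (k₀ - n)) z
      (fun n : ℕ => weylSolution A B z k₀ M (k₀ - n)) := by
  simp only [weylSolution, mul_assoc]
  exact (isHalfLineSolution_jacobiSolution_sub hA z k₀ 1 0).sub
      ((isHalfLineSolution_jacobiSolution_sub hA z k₀ 0 1).mul_const ((A k₀)⁻¹ * M))

theorem summable_Ioi_iff_summable_add (f : ℤ → ℝ) (k₀ : ℤ) :
    (Summable fun k : Set.Ioi k₀ => f k) ↔ Summable fun n : ℕ => f (k₀ + n) := by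
  have hinj : Function.Injective fun n : ℕ => k₀ + (n + 1 : ℕ) := fun p q hpq => by
    simpa using hpq
  have hrange : Set.range (fun n : ℕ => k₀ + (n + 1 : ℕ)) = Set.Ioi k₀ :=
    Set.Subset.antisymm
      (Set.range_subset_iff.2 fun n => by simp only [Set.mem_Ioi]; omega)
      fun k hk => ⟨(k - k₀ - 1).toNat, by rw [Set.mem_Ioi] at hk; push_cast; omega⟩
  rw [← hrange, ← summable_nat_add_iff 1]
  exact (Equiv.ofInjective _ hinj).summable_iff.symm

theorem summable_Iio_iff_summable_sub (f : ℤ → ℝ) (k₀ : ℤ) :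
    (Summable fun k : Set.Iio k₀ => f k) ↔ Summable fun n : ℕ => f (k₀ - n) := by
  have hinj : Function.Injective fun n : ℕ => k₀ - (n + 1 : ℕ) := fun p q hpq => by
    simpa using hpq
  have hrange : Set.range (fun n : ℕ => k₀ - (n + 1 : ℕ)) = Set.Iio k₀ :=
    Set.Subset.antisymm
      (Set.range_subset_iff.2 fun n => by simp only [Set.mem_Iio]; omega)
      fun k hk => ⟨(k₀ - k - 1).toNat, by rw [Set.mem_Iio] at hk; push_cast; omega⟩
  rw [← hrange, ← summable_nat_add_iff 1]
  exact (Equiv.ofInjective _ hinj).summable_iff.symm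

theorem isWeylMatrix_Ioi_iff (hA : ∀ k, IsUnit (A k)) (h : ∀ j k, ‖A j‖ + ‖B k‖ ≤ C)
    (hz : 2 * C < ‖z‖) (k₀ : ℤ) (M : Matrix (Fin m) (Fin m) ℂ) :
    IsWeylMatrix A B (Set.Ioi k₀) z k₀ M ↔
      B k₀ - halfLineWeylFunction (fun n : ℕ => A (k₀ + n)) (fun n : ℕ => B (k₀ + n)) z = M := by
  have hiff := (isHalfLineSolution_weylSolution_add hA z k₀
    M).summable_norm_sq_iff_eq_halfLineWeylFunction (fun n => h _ _) (fun n => hA _) hz (by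
      rw [Nat.cast_zero, add_zero, weylSolution_self])
  simp only [Nat.cast_zero, add_zero, Nat.cast_one, mul_weylSolution_add_one (hA k₀)] at hiff
  refine (summable_Ioi_iff_summable_add (fun k => ‖weylSolution A B z k₀ M k‖ ^ 2) k₀).trans
    (hiff.trans ?_)
  rw [← sub_eq_add_neg, sub_eq_iff_eq_add, sub_eq_iff_eq_add']

theorem isWeylMatrix_Iio_iff (hA : ∀ k, IsUnit (A k)) (h : ∀ j k, ‖A j‖ + ‖B k‖ ≤ C)
    (hz : 2 * C < ‖z‖) (k₀ : ℤ) (M : Matrix (Fin m) (Fin m) ℂ) :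
    IsWeylMatrix A B (Set.Iio k₀) z k₀ M ↔
      halfLineWeylFunction (fun n : ℕ => A (k₀ - 1 - n)) (fun n : ℕ => B (k₀ - n)) z - z • 1
        = M := by
  have hiff := (isHalfLineSolution_weylSolution_sub hA z k₀
    M).summable_norm_sq_iff_eq_halfLineWeylFunction (fun n => h _ _) (fun n => hA _) hz (by
      rw [Nat.cast_zero, sub_zero, weylSolution_self])
  simp only [Nat.cast_zero, sub_zero, Nat.cast_one, mul_weylSolution_sub_one hA] at hiff
  refine (summable_Iio_iff_summable_sub (fun k => ‖weylSolution A B z k₀ M k‖ ^ 2) k₀).trans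
    (hiff.trans ?_)
  rw [add_sub_cancel, eq_comm, sub_eq_iff_eq_add]

theorem weylMatrix_eq_of_forall_isWeylMatrix_iff {S : Set ℤ} {M₀ : Matrix (Fin m) (Fin m) ℂ}
    (h : ∀ M, IsWeylMatrix A B S z k₀ M ↔ M₀ = M) : weylMatrix A B S z k₀ = M₀ := by
  have hex : ∃ M, IsWeylMatrix A B S z k₀ M := ⟨M₀, (h M₀).2 rfl⟩
  rw [weylMatrix, dif_pos hex]
  exact ((h _).1 hex.choose_spec).symm

theorem weylPlus_eventuallyEq (hA : ∀ k, IsUnit (A k)) (h : ∀ j k, ‖A j‖ + ‖B k‖ ≤ C) (k₀ : ℤ) :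
    (weylPlus A B · k₀) =ᶠ[cobounded ℂ] fun z => B k₀ -
      halfLineWeylFunction (fun n : ℕ => A (k₀ + n)) (fun n : ℕ => B (k₀ + n)) z :=
  (eventually_two_mul_lt_norm_cobounded C).mono fun _ hz =>
    weylMatrix_eq_of_forall_isWeylMatrix_iff (isWeylMatrix_Ioi_iff hA h hz k₀)

theorem weylMinus_eventuallyEq (hA : ∀ k, IsUnit (A k)) (h : ∀ j k, ‖A j‖ + ‖B k‖ ≤ C) (k₀ : ℤ) :
    (weylMinus A B · k₀) =ᶠ[cobounded ℂ] fun z =>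
      halfLineWeylFunction (fun n : ℕ => A (k₀ - 1 - n)) (fun n : ℕ => B (k₀ - n)) z - z • 1 :=
  (eventually_two_mul_lt_norm_cobounded C).mono fun _ hz =>
    weylMatrix_eq_of_forall_isWeylMatrix_iff (isWeylMatrix_Iio_iff hA h hz k₀)

theorem exists_forall_forall_norm_add_norm_le (h : ∃ C, ∀ k, ‖A k‖ + ‖B k‖ ≤ C) :
    ∃ C, ∀ j k, ‖A j‖ + ‖B k‖ ≤ C := by
  obtain ⟨C, hC⟩ := h
  refine ⟨C + C, fun j k => add_le_add ?_ ?_⟩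
  · exact (le_add_of_nonneg_right (norm_nonneg _)).trans (hC j)
  · exact (le_add_of_nonneg_left (norm_nonneg _)).trans (hC k)

end JacobiWeyl

section MatrixLocalUniqueness

open scoped MatrixOrder

variable {m : ℕ} {A₁ B₁ A₂ B₂ : ℤ → Matrix (Fin m) (Fin m) ℂ} {C₁ C₂ : ℝ} {l : Filter ℂ} [l.NeBot]
  {N : ℤ}

theorem coeff_eq_of_isBigO_weylMinus_sub (hl : l ≤ cobounded ℂ)
    (hA₁ : ∀ k, (A₁ k).PosDef) (hA₂ : ∀ k, (A₂ k).PosDef)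
    (h₁ : ∀ j k, ‖A₁ j‖ + ‖B₁ k‖ ≤ C₁) (h₂ : ∀ j k, ‖A₂ j‖ + ‖B₂ k‖ ≤ C₂) (k₀ : ℤ)
    (hO : (fun z => weylMinus A₁ B₁ z k₀ - weylMinus A₂ B₂ z k₀) =O[l] fun z => ‖z‖ ^ (-N))
    (k : ℕ) :
    (2 * k + 1 ≤ N → B₁ (k₀ - k) = B₂ (k₀ - k)) ∧
      (2 * k + 2 ≤ N → A₁ (k₀ - 1 - k) = A₂ (k₀ - 1 - k)) := by
  refine coeff_eq_of_isBigO_halfLineWeylFunction_sub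
    (a₁ := fun n : ℕ => A₁ (k₀ - 1 - n)) (b₁ := fun n : ℕ => B₁ (k₀ - n))
    (a₂ := fun n : ℕ => A₂ (k₀ - 1 - n)) (b₂ := fun n : ℕ => B₂ (k₀ - n)) hl
    (fun n => (hA₁ _).isStrictlyPositive) (fun n => (hA₂ _).isStrictlyPositive)
    (fun n => h₁ _ _) (fun n => h₂ _ _) (hO.congr' ?_ .rfl) k
  filter_upwards [hl (weylMinus_eventuallyEq (fun k => (hA₁ k).isUnit) h₁ k₀),
    hl (weylMinus_eventuallyEq (fun k => (hA₂ k).isUnit) h₂ k₀)] with z hz₁ hz₂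
  rw [hz₁, hz₂, sub_sub_sub_cancel_right]

theorem coeff_eq_of_isBigO_weylPlus_sub (hl : l ≤ cobounded ℂ)
    (hA₁ : ∀ k, (A₁ k).PosDef) (hA₂ : ∀ k, (A₂ k).PosDef)
    (h₁ : ∀ j k, ‖A₁ j‖ + ‖B₁ k‖ ≤ C₁) (h₂ : ∀ j k, ‖A₂ j‖ + ‖B₂ k‖ ≤ C₂) (k₀ : ℤ)
    (hO : (fun z => weylPlus A₁ B₁ z k₀ - weylPlus A₂ B₂ z k₀) =O[l] fun z => ‖z‖ ^ (-N))
    (hB : B₁ k₀ = B₂ k₀) (k : ℕ) :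
    (2 * k + 1 ≤ N → B₁ (k₀ + k) = B₂ (k₀ + k)) ∧
      (2 * k + 2 ≤ N → A₁ (k₀ + k) = A₂ (k₀ + k)) := by
  refine coeff_eq_of_isBigO_halfLineWeylFunction_sub
    (a₁ := fun n : ℕ => A₁ (k₀ + n)) (b₁ := fun n : ℕ => B₁ (k₀ + n))
    (a₂ := fun n : ℕ => A₂ (k₀ + n)) (b₂ := fun n : ℕ => B₂ (k₀ + n)) hl
    (fun n => (hA₁ _).isStrictlyPositive) (fun n => (hA₂ _).isStrictlyPositive)
    (fun n => h₁ _ _) (fun n => h₂ _ _) (hO.neg_left.congr' ?_ .rfl) k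
  filter_upwards [hl (weylPlus_eventuallyEq (fun k => (hA₁ k).isUnit) h₁ k₀),
    hl (weylPlus_eventuallyEq (fun k => (hA₂ k).isUnit) h₂ k₀)] with z hz₁ hz₂
  rw [hz₁, hz₂, hB, neg_sub, sub_sub_sub_cancel_left]

end MatrixLocalUniqueness

theorem theorem4_general {m : ℕ} {A₁ B₁ A₂ B₂ : ℤ → Matrix (Fin m) (Fin m) ℂ}
    (hA₁ : ∀ k, (A₁ k).PosDef) (h₁ : ∃ C : ℝ, ∀ k, ‖A₁ k‖ + ‖B₁ k‖ ≤ C)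
    (hA₂ : ∀ k, (A₂ k).PosDef) (h₂ : ∃ C : ℝ, ∀ k, ‖A₂ k‖ + ‖B₂ k‖ ≤ C) (k₀ : ℤ)
    {l : Filter ℂ} [l.NeBot] (hl : l ≤ cobounded ℂ) :
    (∀ N : ℕ, 2 ≤ N →
      ((fun z : ℂ => weylMinus A₁ B₁ z k₀ - weylMinus A₂ B₂ z k₀)
        =O[l] fun z : ℂ => ‖z‖ ^ (-(N : ℤ))) →
      (∀ k : ℕ, k ≤ N / 2 - 1 → A₁ (k₀ - 1 - k) = A₂ (k₀ - 1 - k)) ∧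
      (∀ k : ℕ, k ≤ (N - 1) / 2 → B₁ (k₀ - k) = B₂ (k₀ - k))) ∧
    (∀ N : ℕ, 2 ≤ N →
      ((fun z : ℂ => weylPlus A₁ B₁ z k₀ - weylPlus A₂ B₂ z k₀)
        =O[l] fun z : ℂ => ‖z‖ ^ (-(N : ℤ))) →
      B₁ k₀ = B₂ k₀ →
      (∀ k : ℕ, k ≤ N / 2 - 1 → A₁ (k₀ + k) = A₂ (k₀ + k)) ∧
      (∀ k : ℕ, k ≤ (N - 1) / 2 → B₁ (k₀ + k) = B₂ (k₀ + k))) := by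
  obtain ⟨C₁, h₁⟩ := exists_forall_forall_norm_add_norm_le h₁
  obtain ⟨C₂, h₂⟩ := exists_forall_forall_norm_add_norm_le h₂
  refine ⟨fun N hN hO => ?_, fun N hN hO hB => ?_⟩
  · have hcoeff := coeff_eq_of_isBigO_weylMinus_sub hl hA₁ hA₂ h₁ h₂ k₀ hO
    exact ⟨fun k hk => (hcoeff k).2 (by omega), fun k hk => (hcoeff k).1 (by omega)⟩
  · have hcoeff := coeff_eq_of_isBigO_weylPlus_sub hl hA₁ hA₂ h₁ h₂ k₀ hO hB
    exact ⟨fun k hk => (hcoeff k).2 (by omega), fun k hk => (hcoeff k).1 (by omega)⟩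

theorem rayAtInfinity_neBot {α : ℝ} (hα : α ∈ Set.Ioc (-Real.pi) Real.pi) :
    (rayAtInfinity α).NeBot := by
  have hray : Tendsto (fun r : ℝ => r * (Complex.cos α + Complex.sin α * Complex.I)) atTop
      (rayAtInfinity α) := by
    refine tendsto_inf.2 ⟨tendsto_norm_atTop_iff_cobounded.1 ?_, tendsto_principal.2 ?_⟩
    · simpa only [norm_mul, Complex.norm_cos_add_sin_mul_I, mul_one, Complex.norm_real] using
        tendsto_norm_atTop_atTop
    · filter_upwards [eventually_gt_atTop 0] with r hr
      exact Complex.arg_mul_cos_add_sin_mul_I hr hα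
  exact hray.neBot

theorem theorem4 (m : ℕ) (ε : ℝ) (hε₀ : 0 < ε) (hεπ : ε < Real.pi)
    (A₁ B₁ A₂ B₂ : ℤ → Matrix (Fin m) (Fin m) ℂ)
    (h₁ : IsJacobiData A₁ B₁) (h₂ : IsJacobiData A₂ B₂) (k₀ : ℤ) :
    (∀ N : ℕ, 2 ≤ N →
      ((fun z : ℂ => weylMinus A₁ B₁ z k₀ - weylMinus A₂ B₂ z k₀)
        =O[rayAtInfinity (Real.pi - ε)] fun z : ℂ => ‖z‖ ^ (-(N : ℤ))) →
      (∀ k : ℕ, k ≤ N / 2 - 1 → A₁ (k₀ - 1 - k) = A₂ (k₀ - 1 - k)) ∧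
      (∀ k : ℕ, k ≤ (N - 1) / 2 → B₁ (k₀ - k) = B₂ (k₀ - k))) ∧
    (∀ N : ℕ, 2 ≤ N →
      ((fun z : ℂ => weylPlus A₁ B₁ z k₀ - weylPlus A₂ B₂ z k₀)
        =O[rayAtInfinity (Real.pi - ε)] fun z : ℂ => ‖z‖ ^ (-(N : ℤ))) →
      B₁ k₀ = B₂ k₀ →
      (∀ k : ℕ, k ≤ N / 2 - 1 → A₁ (k₀ + k) = A₂ (k₀ + k)) ∧
      (∀ k : ℕ, k ≤ (N - 1) / 2 → B₁ (k₀ + k) = B₂ (k₀ + k))) := by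
  have := rayAtInfinity_neBot (α := Real.pi - ε) ⟨by linarith, by linarith⟩
  exact theorem4_general h₁.posDef h₁.bounded h₂.posDef h₂.bounded k₀ inf_le_left
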